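/- **Setting.** Let $\Sigma=\Sigma_C\uplus\Sigma_D$ be a signature of constructors and defined symbols and $\mathcal V$ a set of variables. For each $f\in\Sigma_D$ let $f^\#$ be a fresh tuple symbol of the same arity, $\Sigma^\#=\{f^\#\mid f\in\Sigma_D\}$, and for each $n\in\mathbb N$ let $\mathsf{c}_n$ be a fresh compound symbol of arity $n$. For $t=f(t_1,\ldots,t_n)$ with $f\in\Sigma_D$ let $t^\#=f^\#(t_1,\ldots,t_n)$. In the following, terms are built from $\Sigma$, $\Sigma^\#$, the compound symbols and $\mathcal V$, unless they are said to be over $\Sigma$. The content of a term is the multiset given by $cont(\mathsf{c}_n(t_1,\ldots,t_n))=cont(t_1)\cup\cdots\cup cont(t_n)$ and $cont(t)=\{t\}$ for all other $t$; terms with the same content are identified when they occur as labels of trees or in the steps below, and any such term with content $\{s_1,\ldots,s_n\}$ is written as $\mathsf{c}_n(s_1,\ldots,s_n)$. For a term $r$ over $\Sigma$, $dp(r)=\mathsf{c}_n(t_1^\#,\ldots,t_n^\#)$, where $t_1,\ldots,t_n$ are all occurrences of subterms of $r$ with defined root. A finite multi-distribution is a finite multiset $\{p_1:a_1,\ldots,p_k:a_k\}$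 with $0<p_j\le 1$ and $\sum_j p_j=1$. A *PTRS* is a finite set of rules $\ell\to\{p_1:r_1,\ldots,p_k:r_k\}$ with terms over $\Sigma$, $\ell\notin\mathcal V$ and $\mathcal V(r_j)\subseteq\mathcal V(\ell)$. A *PPTRS* is a finite set of dependency tuples (DTs) $\langle\ell^\#,\ell\rangle\to\{p_1:\langle d_1,r_1\rangle,\ldots,p_k:\langle d_k,r_k\rangle\}$, where $\ell$ has a defined root, such that the rules $\ell\to\{p_1:r_1,\ldots,p_k:r_k\}$ form a PTRS and $cont(d_j)\subseteq cont(dp(r_j))$ for all $j$. A *DP problem* $(\mathcal P,\mathcal S)$ consists of a PPTRS $\mathcal P$ and a PTRS $\mathcal S$. A term is in $\mathtt{NF}_{\mathcal S}$ if none of its subterms is an instance of a left-hand side of $\mathcal S$. *Steps with $\mathcal P$.* $\mathsf{c}_n(s_1,\ldots,s_n)$ rewrites with $(\mathcal P,\mathcal S)$ to $\{p_1:b_1,\ldots,p_k:b_k\}$ if there are a DT in $\mathcal P$ as above, an $i$ and a substitution $\sigma$ with $s_i=\ell^\#\sigma\in\mathtt{NF}_{\mathcal S}$, and $b_j=\mathsf{c}_n(t_1^j,\ldots,t_n^j)$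 where $t_i^j=d_j\sigma$ for all $j$ and for each $i'\neq i$ either $t_{i'}^j=s_{i'}$ for all $j$, or, for some position $\tau$ with $s_{i'}|_\tau=\ell\sigma$, $t_{i'}^j=s_{i'}[r_j\sigma]_\tau$ for all $j$; the latter is only allowed if $\ell\to\{p_1:r_1,\ldots,p_k:r_k\}\in\mathcal S$. *Steps with $\mathcal S$.* $\mathsf{c}_n(s_1,\ldots,s_n)$ rewrites with $\mathcal S$ to $\{p_1:b_1,\ldots,p_k:b_k\}$ if there are a rule $\ell\to\{p_1:r_1,\ldots,p_k:r_k\}\in\mathcal S$, an $i$, a position $\pi$ and a substitution $\sigma$ with $s_i|_\pi=\ell\sigma$ such that all proper subterms of $\ell\sigma$ are in $\mathtt{NF}_{\mathcal S}$, and $b_j=\mathsf{c}_n(t_1^j,\ldots,t_n^j)$ where $t_i^j=s_i[r_j\sigma]_\pi$ for all $j$ and for each $i'\neq i$ either $t_{i'}^j=s_{i'}$ for all $j$, or, for some position $\tau$ with $s_{i'}|_\tau=\ell\sigma$, $t_{i'}^j=s_{i'}[r_j\sigma]_\tau$ for all $j$. An (innermost) *$(\mathcal P,\mathcal S)$-chain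 tree* is a non-empty, possibly infinite, finitely branching rooted directed tree whose nodes $v$ are labeled by a probability $p_v\in(0,1]$ and a term $t_v$, together with a set $P$ of inner nodes, such that the root has probability $1$; for each inner node $v$ with successors $w_1,\ldots,w_k$, the term $t_v$ rewrites to $\{\tfrac{p_{w_1}}{p_v}:t_{w_1},\ldots,\tfrac{p_{w_k}}{p_v}:t_{w_k}\}$ with $(\mathcal P,\mathcal S)$ if $v\in P$ and with $\mathcal S$ if $v\notin P$; and every infinite path contains infinitely many nodes from $P$. The DP problem $(\mathcal P,\mathcal S)$ is *iAST* if for every $(\mathcal P,\mathcal S)$-chain tree the probabilities of all leaves sum up to $1$. A processor that maps $(\mathcal P,\mathcal S)$ to a set of DP problems is *sound* if $(\mathcal P,\mathcal S)$ is iAST whenever all DP problems in that set are iAST, and *complete* if all DP problems in that set are iAST whenever $(\mathcal P,\mathcal S)$ is iAST. A polynomial interpretation $\mathrm{Pol}$ maps every symbol $g$ (including tuple and compound symbols) of arity $n$ to a polynomial $g_{\mathrm{Pol}}\in\mathbb N[x_1,\ldots,x_n]$ and is extended to terms homomorphically. It is *weakly monotonic* if every $g_{\mathrm{Pol}}$ is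 weakly monotonic in every argument over $\mathbb N$, *multilinear* if all exponents in all monomials of every $g_{\mathrm{Pol}}$ are $0$ or $1$, and *compound-additive* if $(\mathsf{c}_n)_{\mathrm{Pol}}(x_1,\ldots,x_n)=x_1+\cdots+x_n$ for all $n$. An inequation between interpretations of terms holds if it is true for all instantiations of the variables by natural numbers. **Theorem (Probabilistic Reduction Pair Processor).** Let $(\mathcal P,\mathcal S)$ be a DP problem and let $\mathrm{Pol}$ be a weakly monotonic, multilinear, and compound-additive polynomial interpretation. Let $\mathcal P=\mathcal P_\ge\uplus\mathcal P_>$ with $\mathcal P_>\neq\emptyset$ such that: 1. For every $\ell\to\{p_1:r_1,\ldots,p_k:r_k\}\in\mathcal S$, we have $\mathrm{Pol}(\ell)\ge\sum_{1\le j\le k}p_j\cdot\mathrm{Pol}(r_j)$. 2. For every $\langle\ell^\#,\ell\rangle\to\{p_1:\langle d_1,r_1\rangle,\ldots,p_k:\langle d_k,r_k\rangle\}\in\mathcal P$, we have $\mathrm{Pol}(\ell^\#)\ge\sum_{1\le j\le k}p_j\cdot\mathrm{Pol}(d_j)$. 3. For every $\langle\ell^\#,\ell\rangle\to\{p_1:\langle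 d_1,r_1\rangle,\ldots,p_k:\langle d_k,r_k\rangle\}\in\mathcal P_>$, there is a $1\le j\le k$ with $\mathrm{Pol}(\ell^\#)>\mathrm{Pol}(d_j)$ such that, if $\ell\to\{p_1:r_1,\ldots,p_k:r_k\}\in\mathcal S$, then additionally $\mathrm{Pol}(\ell)\ge\mathrm{Pol}(r_j)$ for the same $j$. Then the processor that maps $(\mathcal P,\mathcal S)$ to $\{(\mathcal P_\ge,\mathcal S)\}$ is sound and complete. -/

import Mathlib

namespace ProbDP

universe u v

/-! ## Terms -/

/-- A signature, already split into constructors and defined symbols. -/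
structure Signature where
  /-- the constructors -/
  Con : Type u
  /-- the defined symbols -/
  Def : Type u
  conArity : Con → ℕ
  defArity : Def → ℕ

/-- The extended signature: the symbols of the signature, a tuple symbol of the same arity for every
defined symbol, and a compound symbol of arity `n` for every `n`. -/
inductive Sym (F : Signature.{u}) : Type u
  | con (c : F.Con)
  | defd (f : F.Def)
  | tup (f : F.Def)
  | com (n : ℕ)

/-- The arity of a symbol. -/
def Sym.arity {F : Signature.{u}} : Sym F → ℕ
  | .con c => F.conArity c
  | .defd f => F.defArity f
  | .tup f => F.defArity f
  | .com n => n

/-- Terms over the extended signature with variables from `X`. -/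
inductive Term (F : Signature.{u}) (X : Type v) : Type (max u v)
  | var (x : X)
  | app (g : Sym F) (ts : Fin g.arity → Term F X)

namespace Term

variable {F : Signature.{u}} {X : Type v}

/-- The set of variables of a term. -/
def vars : Term F X → Set X
  | var x => {x}
  | app _ ts => {x | ∃ i, x ∈ (ts i).vars}

/-- Application of a substitution. -/
def subst (σ : X → Term F X) : Term F X → Term F X
  | var x => σ x
  | app g ts => app g (fun i => (ts i).subst σ)

/-- The terms over the original signature, i.e. without tuple symbols and compound symbols. -/
def IsBase : Term F X → Prop
  | var _ => True
  | app (.con _) ts => ∀ i, (ts i).IsBase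
  | app (.defd _) ts => ∀ i, (ts i).IsBase
  | app (.tup _) _ => False
  | app (.com _) _ => False

/-- The root of the term is a defined symbol. -/
def HasDefinedRoot : Term F X → Prop
  | app (.defd _) _ => True
  | _ => False

/-- `t.sharp` replaces a defined root symbol of `t` by its tuple symbol
(it is only used for terms with a defined root). -/
def sharp : Term F X → Term F X
  | app (.defd f) ts => app (.tup f) ts
  | t => t

/-- The subterm at a position (`none` if this is not a position of the term).
Positions are lists of argument indices, counted from `0`. -/
def subAt : Term F X → List ℕ → Option (Term F X)
  | t, [] => some t
  | var _, _ :: _ => none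
  | app g ts, i :: π => if h : i < g.arity then (ts ⟨i, h⟩).subAt π else none

/-- `t.replaceAt π s` is the term `t` with the subterm at position `π` replaced by `s`
(it is only used for positions of `t`). -/
def replaceAt : Term F X → List ℕ → Term F X → Term F X
  | _, [], s => s
  | var x, _ :: _, _ => var x
  | app g ts, i :: π, s =>
      app g (fun j => if (j : ℕ) = i then (ts j).replaceAt π s else ts j)

/-- The list of all occurrences of subterms with defined root symbol, ordered lexicographically by
their positions. -/
def defSubs : Term F X → List (Term F X)
  | var _ => []
  | app (.defd f) ts => app (.defd f) ts :: (List.ofFn fun i => (ts i).defSubs).flatten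
  | app (.con c) ts => (List.ofFn fun i : Fin (Sym.con c).arity => (ts i).defSubs).flatten
  | app (.tup f) ts => (List.ofFn fun i : Fin (Sym.tup f).arity => (ts i).defSubs).flatten
  | app (.com n) ts => (List.ofFn fun i : Fin (Sym.com n).arity => (ts i).defSubs).flatten

/-- The compound term that collects the sharped subterms of `r` with defined root symbol. -/
def dp (r : Term F X) : Term F X :=
  app (.com r.defSubs.length) (fun i => (r.defSubs.get i).sharp)

/-- The content of a term: the multiset of arguments that remains after removing (nested) compound
symbols from the top of the term. -/
def cont : Term F X → Multiset (Term F X)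
  | var x => {var x}
  | app (.com n) ts => ∑ i : Fin (Sym.com n).arity, (ts i).cont
  | app (.con c) ts => {app (.con c) ts}
  | app (.defd f) ts => {app (.defd f) ts}
  | app (.tup f) ts => {app (.tup f) ts}

end Term

/-! ## Multi-distributions and rewrite systems -/

/-- Finite multi-distributions on `A`. -/
@[ext]
structure FDist (A : Type*) where
  weights : Multiset (ℝ × A)
  pos : ∀ x ∈ weights, 0 < x.1
  le_one : ∀ x ∈ weights, x.1 ≤ 1
  sum_eq_one : (weights.map Prod.fst).sum = 1

/-- `{p₁ : f a₁, …, pₖ : f aₖ}` for a multi-distribution `{p₁ : a₁, …, pₖ : aₖ}`. -/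
def FDist.map {A B : Type*} (f : A → B) (μ : FDist A) : FDist B where
  weights := μ.weights.map (fun x => (x.1, f x.2))
  pos := by
    intro x hx
    obtain ⟨y, hy, rfl⟩ := Multiset.mem_map.1 hx
    exact μ.pos y hy
  le_one := by
    intro x hx
    obtain ⟨y, hy, rfl⟩ := Multiset.mem_map.1 hx
    exact μ.le_one y hy
  sum_eq_one := by
    rw [Multiset.map_map]
    exact μ.sum_eq_one

/-- A pair `ℓ → {p₁ : r₁, …, pₖ : rₖ}`. -/
structure ProbRule (F : Signature.{u}) (X : Type v) where
  lhs : Term F X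
  rhs : FDist (Term F X)

/-- Probabilistic term rewrite systems over the original signature: finite sets of rules whose
left-hand side is not a variable and contains all variables of the right-hand sides. -/
def IsPTRS {F : Signature.{u}} {X : Type v} (S : Set (ProbRule F X)) : Prop :=
  S.Finite ∧ ∀ ρ ∈ S, (∀ x, ρ.lhs ≠ .var x) ∧ ρ.lhs.IsBase ∧
    ∀ y ∈ ρ.rhs.weights, y.2.IsBase ∧ y.2.vars ⊆ ρ.lhs.vars

/-- A coupled dependency tuple `⟨ℓ♯, ℓ⟩ → {p₁ : ⟨d₁, r₁⟩, …, pₖ : ⟨dₖ, rₖ⟩}`.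
Since `ℓ♯` is determined by `ℓ`, only `ℓ` is stored. -/
structure DepTuple (F : Signature.{u}) (X : Type v) where
  lhs : Term F X
  rhs : FDist (Term F X × Term F X)

namespace DepTuple

variable {F : Signature.{u}} {X : Type v}

/-- The first component `ℓ♯ → {p₁ : d₁, …, pₖ : dₖ}`. -/
def proj₁ (δ : DepTuple F X) : ProbRule F X := ⟨δ.lhs.sharp, δ.rhs.map Prod.fst⟩

/-- The second component `ℓ → {p₁ : r₁, …, pₖ : rₖ}`. -/
def proj₂ (δ : DepTuple F X) : ProbRule F X := ⟨δ.lhs, δ.rhs.map Prod.snd⟩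

end DepTuple

/-- Probabilistic pair term rewrite systems. -/
def IsPPTRS {F : Signature.{u}} {X : Type v} (P : Set (DepTuple F X)) : Prop :=
  P.Finite ∧ IsPTRS (DepTuple.proj₂ '' P) ∧
    ∀ δ ∈ P, δ.lhs.HasDefinedRoot ∧ ∀ y ∈ δ.rhs.weights, y.2.1.cont ≤ y.2.2.dp.cont

theorem IsPPTRS.mono {F : Signature.{u}} {X : Type v} {P P' : Set (DepTuple F X)}
    (hP : IsPPTRS P) (h : P' ⊆ P) : IsPPTRS P' :=
  ⟨hP.1.subset h,
    ⟨(hP.1.subset h).image _, fun ρ hρ => hP.2.1.2 ρ (Set.image_mono h hρ)⟩,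
    fun δ hδ => hP.2.2 δ (h hδ)⟩

/-- A probabilistic DP problem `(P, S)`. -/
structure DPProblem (F : Signature.{u}) (X : Type v) where
  P : Set (DepTuple F X)
  S : Set (ProbRule F X)
  isPPTRS : IsPPTRS P
  isPTRS : IsPTRS S

/-- The DP problem `(P', S)` for a subset `P'` of the dependency tuples of `(P, S)`. -/
def DPProblem.restrict {F : Signature.{u}} {X : Type v} (Q : DPProblem F X)
    (P' : Set (DepTuple F X)) (h : P' ⊆ Q.P) : DPProblem F X :=
  ⟨P', Q.S, Q.isPPTRS.mono h, Q.isPTRS⟩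

/-! ## The innermost rewrite relations on compound terms -/

section Steps

variable {F : Signature.{u}} {X : Type v}

/-- `t` is in normal form w.r.t. `S`: no subterm is an instance of a left-hand side of `S`. -/
def IsNF (S : Set (ProbRule F X)) (t : Term F X) : Prop :=
  ∀ ρ ∈ S, ∀ (π : List ℕ) (σ : X → Term F X), t.subAt π ≠ some (ρ.lhs.subst σ)

/-- Every proper subterm of `t` is in normal form w.r.t. `S`. -/
def ProperSubtermsNF (S : Set (ProbRule F X)) (t : Term F X) : Prop :=
  ∀ (π : List ℕ) (s : Term F X), π ≠ [] → t.subAt π = some s → IsNF S s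

/-- Equality of multisets of weighted terms up to equal contents of the terms. -/
def ContEq (μ ν : Multiset (ℝ × Term F X)) : Prop :=
  μ.map (fun x => (x.1, x.2.cont)) = ν.map (fun x => (x.1, x.2.cont))

/-- `s` stays the same (`none`) or its subterm at position `τ` is replaced by `u` (`some τ`). -/
def optReplace (s : Term F X) (o : Option (List ℕ)) (u : Term F X) : Term F X :=
  match o with
  | none => s
  | some τ => s.replaceAt τ u

/-- The step `a ⇾ ν` with the dependency tuples of `P` w.r.t. `S`. Terms are considered up to
equality of contents: `a` is `Com n (s₁, …, sₙ)`, and the multi-distribution `ν` consists of the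
terms `Com n (t₁ʲ, …, tₙʲ)`. The value `c i'` says whether the term `s i'` with `i' ≠ i` stays the
same or at which position the second component of the dependency tuple is applied to it. -/
def TupleStep (P : Set (DepTuple F X)) (S : Set (ProbRule F X))
    (a : Term F X) (ν : Multiset (ℝ × Term F X)) : Prop :=
  ∃ (n : ℕ) (s : Fin n → Term F X) (i : Fin n) (δ : DepTuple F X) (σ : X → Term F X)
    (c : Fin n → Option (List ℕ)),
    a.cont = Finset.univ.val.map s ∧
    δ ∈ P ∧ s i = δ.lhs.sharp.subst σ ∧ IsNF S (s i) ∧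
    (∀ i', i' ≠ i → ∀ τ, c i' = some τ →
      (s i').subAt τ = some (δ.lhs.subst σ) ∧ δ.proj₂ ∈ S) ∧
    ContEq ν (δ.rhs.weights.map fun x =>
      (x.1, .app (.com n) fun i' : Fin n =>
        if i' = i then x.2.1.subst σ else optReplace (s i') (c i') (x.2.2.subst σ)))

/-- The step `a ⇾ ν` with the rules of `S`, with the same conventions as in `TupleStep`. -/
def RuleStep (S : Set (ProbRule F X)) (a : Term F X) (ν : Multiset (ℝ × Term F X)) : Prop :=
  ∃ (n : ℕ) (s : Fin n → Term F X) (i : Fin n) (ρ : ProbRule F X) (π : List ℕ)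
    (σ : X → Term F X) (c : Fin n → Option (List ℕ)),
    a.cont = Finset.univ.val.map s ∧
    ρ ∈ S ∧ (s i).subAt π = some (ρ.lhs.subst σ) ∧ ProperSubtermsNF S (ρ.lhs.subst σ) ∧
    (∀ i', i' ≠ i → ∀ τ, c i' = some τ → (s i').subAt τ = some (ρ.lhs.subst σ)) ∧
    ContEq ν (ρ.rhs.weights.map fun x =>
      (x.1, .app (.com n) fun i' : Fin n =>
        if i' = i then (s i).replaceAt π (x.2.subst σ)
        else optReplace (s i') (c i') (x.2.subst σ)))

end Steps

/-! ## Chain trees -/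

/-- Innermost `(P, S)`-chain trees. The set of successors of a node is given as a finite set. A
finitely branching rooted tree is countable, so node types in `Type` give all chain trees. -/
structure ChainTree {F : Signature.{u}} {X : Type v} (Q : DPProblem F X) where
  Node : Type
  root : Node
  succ : Node → Finset Node
  root_not_mem : ∀ v, root ∉ succ v
  unique_pred : ∀ w, w ≠ root → ∃! v, w ∈ succ v
  reachable : ∀ v, Relation.ReflTransGen (fun x y => y ∈ succ x) root v
  prob : Node → ℝ
  prob_pos : ∀ v, 0 < prob v
  prob_le_one : ∀ v, prob v ≤ 1
  prob_root : prob root = 1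
  label : Node → Term F X
  /-- the inner nodes where a dependency tuple is used -/
  PNode : Set Node
  inner_of_PNode : ∀ v ∈ PNode, (succ v).Nonempty
  tuple_step : ∀ v ∈ PNode,
    TupleStep Q.P Q.S (label v) ((succ v).val.map fun w => (prob w / prob v, label w))
  rule_step : ∀ v ∉ PNode, (succ v).Nonempty →
    RuleStep Q.S (label v) ((succ v).val.map fun w => (prob w / prob v, label w))
  infinite_PNode : ∀ path : ℕ → Node, (∀ n, path (n + 1) ∈ succ (path n)) →
    {n | path n ∈ PNode}.Infinite

/-- The sum of the probabilities of all leaves. -/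
noncomputable def ChainTree.leafProb {F : Signature.{u}} {X : Type v} {Q : DPProblem F X}
    (T : ChainTree Q) : ENNReal :=
  ∑' v : {v : T.Node // T.succ v = ∅}, ENNReal.ofReal (T.prob v)

/-- `(P, S)` is innermost almost-surely terminating. -/
def DPProblem.IsIAST {F : Signature.{u}} {X : Type v} (Q : DPProblem F X) : Prop :=
  ∀ T : ChainTree Q, T.leafProb = 1

/-- A DP processor that maps `Q` to the set `R` of DP problems is sound on `Q`. -/
def ProcessorSound {F : Signature.{u}} {X : Type v} (Q : DPProblem F X)
    (R : Set (DPProblem F X)) : Prop :=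
  (∀ Q' ∈ R, Q'.IsIAST) → Q.IsIAST

/-- A DP processor that maps `Q` to the set `R` of DP problems is complete on `Q`. -/
def ProcessorComplete {F : Signature.{u}} {X : Type v} (Q : DPProblem F X)
    (R : Set (DPProblem F X)) : Prop :=
  Q.IsIAST → ∀ Q' ∈ R, Q'.IsIAST

/-! ## Polynomial interpretations -/

/-- A polynomial interpretation of the extended signature with natural coefficients. -/
structure PolyInterp (F : Signature.{u}) where
  poly : ∀ g : Sym F, MvPolynomial (Fin g.arity) ℕ

namespace PolyInterp

variable {F : Signature.{u}} {X : Type v}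

/-- The value of the polynomial interpretation of a term when its variables are instantiated
by `α`. -/
noncomputable def eval (I : PolyInterp F) (α : X → ℕ) : Term F X → ℕ
  | .var x => α x
  | .app g ts => MvPolynomial.eval (fun i => I.eval α (ts i)) (I.poly g)

/-- All polynomials are weakly monotonic in each argument. -/
def WeaklyMonotonic (I : PolyInterp F) : Prop :=
  ∀ (g : Sym F) (a : Fin g.arity → ℕ) (i : Fin g.arity) (x y : ℕ), y ≤ x →
    MvPolynomial.eval (Function.update a i y) (I.poly g) ≤
      MvPolynomial.eval (Function.update a i x) (I.poly g)

/-- All exponents in all monomials are `0` or `1`. -/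
def Multilinear (I : PolyInterp F) : Prop :=
  ∀ (g : Sym F), ∀ m ∈ (I.poly g).support, ∀ i, m i ≤ 1

/-- Compound symbols are interpreted by the sum of their arguments. -/
def ComAdditive (I : PolyInterp F) : Prop :=
  ∀ n : ℕ, I.poly (.com n) = ∑ i : Fin (Sym.com n : Sym F).arity, MvPolynomial.X i

/-- `Pol(s) ≥ Pol(t)` -/
def Ge (I : PolyInterp F) (s t : Term F X) : Prop :=
  ∀ α : X → ℕ, I.eval α t ≤ I.eval α s

/-- `Pol(s) > Pol(t)` -/
def Gt (I : PolyInterp F) (s t : Term F X) : Prop :=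
  ∀ α : X → ℕ, I.eval α t < I.eval α s

/-- `Pol(ℓ) ≥ p₁ * Pol(r₁) + … + pₖ * Pol(rₖ)` for a rule `ℓ → {p₁ : r₁, …, pₖ : rₖ}`. -/
def ExpectedGe (I : PolyInterp F) (ρ : ProbRule F X) : Prop :=
  ∀ α : X → ℕ, (ρ.rhs.weights.map fun x => x.1 * (I.eval α x.2 : ℝ)).sum ≤
    (I.eval α ρ.lhs : ℝ)

end PolyInterp

end ProbDP

open ProbDP

/-! Completeness is immediate: a chain tree that uses only tuples of `Pge` is also a chain tree for
the full problem.

For soundness, fix a chain tree and let `V` be the interpretation of a node's label under a fixed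
instantiation. Multilinearity makes the value of a term affine in the value of any subterm, and
compound additivity splits it over the content. Hence the weak inequations lift from rules to steps,
and `V` is an `ℕ`-valued supermartingale along the tree. Let `G` be the set of nodes whose tuple
step is not available in `Pge`. There `V` drops with conditional probability at least some `ε > 0`,
uniform because `Pgt` is finite. Cutting the tree at `G` gives chain trees for `Pge`, so, from every
node, the mass that avoids `G` vanishes (`ChainTree.tendsto_cut_mass`).

What remains is analytic (`tendsto_mass_zero`). A drop of `V` on one branch may be compensated by a
rise on another, so `V` itself need not lose expected value. The strictly concave transform `V / (V
+ 1)` does: at a node of `G` with `V ≤ M`, its weighted value loses at least `ε / (M + 1) ^ 3` times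
the mass. These losses are absorbed by a potential, that is, a superharmonic function whose iterated
successor sums tend to `0`. Nodes with `V > M` are handled by a Markov bound. A maximum principle
(`harmonic_le_of_le_on`) carries the estimate from `G` to all nodes, and `M → ∞` leaves no mass on
infinite branches. By `tsum_leaves_eq_one_iff` this means that the leaves have total probability
one. -/

namespace ProbDP

open Filter Topology

/-! ## Superharmonic functions on finitely branching graphs -/

section SuccSum

variable {N : Type*} (succ : N → Finset N)

/-- The sum of the values of `f` at the successors of a node. -/
def succSum (f : N → ℝ) (v : N) : ℝ := ∑ w ∈ succ v, f w

variable {succ}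

theorem succSum_mono {f g : N → ℝ} (h : ∀ v, f v ≤ g v) (v : N) :
    succSum succ f v ≤ succSum succ g v :=
  Finset.sum_le_sum fun w _ => h w

theorem iterate_succSum_succ (f : N → ℝ) (n : ℕ) (v : N) :
    (succSum succ)^[n + 1] f v = ∑ w ∈ succ v, (succSum succ)^[n] f w := by
  rw [Function.iterate_succ_apply']; rfl

theorem iterate_succSum_mono {f g : N → ℝ} (h : ∀ v, f v ≤ g v) (n : ℕ) (v : N) :
    (succSum succ)^[n] f v ≤ (succSum succ)^[n] g v := by
  induction n generalizing v with
  | zero => exact h v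
  | succ n ih =>
    simp only [iterate_succSum_succ]
    exact Finset.sum_le_sum fun w _ => ih w

theorem iterate_succSum_nonneg {f : N → ℝ} (h : ∀ v, 0 ≤ f v) (n : ℕ) (v : N) :
    0 ≤ (succSum succ)^[n] f v := by
  induction n generalizing v with
  | zero => exact h v
  | succ n ih =>
    simp only [iterate_succSum_succ]
    exact Finset.sum_nonneg fun w _ => ih w

theorem iterate_succSum_add_mul (a b : ℝ) (f g : N → ℝ) (n : ℕ) (v : N) :
    (succSum succ)^[n] (fun v => a * f v + b * g v) v =
      a * (succSum succ)^[n] f v + b * (succSum succ)^[n] g v := by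
  induction n generalizing v with
  | zero => rfl
  | succ n ih =>
    simp only [iterate_succSum_succ, ih, Finset.sum_add_distrib, Finset.mul_sum]

theorem iterate_succSum_of_harmonic {f : N → ℝ} (h : ∀ v, succSum succ f v = f v) (n : ℕ)
    (v : N) : (succSum succ)^[n] f v = f v := by
  rw [Function.iterate_fixed (funext h)]

theorem iterate_succSum_le {f : N → ℝ} (h : ∀ v, succSum succ f v ≤ f v) (n : ℕ) (v : N) :
    (succSum succ)^[n] f v ≤ f v := by
  induction n generalizing v with
  | zero => exact le_rfl
  | succ n ih =>
    rw [iterate_succSum_succ]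
    exact (Finset.sum_le_sum fun w _ => ih w).trans (h v)

/-- The iterated successor sums of a nonnegative superharmonic function converge to a
harmonic function. -/
theorem exists_harmonic_limit {f : N → ℝ} (h0 : ∀ v, 0 ≤ f v)
    (h : ∀ v, succSum succ f v ≤ f v) :
    ∃ u : N → ℝ, (∀ v, 0 ≤ u v) ∧ (∀ v, u v ≤ f v) ∧ (∀ v, succSum succ u v = u v) ∧
      ∀ v, Tendsto (fun n => (succSum succ)^[n] f v) atTop (𝓝 (u v)) := by
  have hanti : ∀ v, Antitone fun n => (succSum succ)^[n] f v := fun v =>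
    antitone_nat_of_succ_le fun n => by
      rw [Function.iterate_succ_apply]
      exact iterate_succSum_mono h n v
  have hbdd : ∀ v, BddBelow (Set.range fun n => (succSum succ)^[n] f v) := fun v =>
    ⟨0, by rintro _ ⟨n, rfl⟩; exact iterate_succSum_nonneg h0 n v⟩
  have hlim : ∀ v, Tendsto (fun n => (succSum succ)^[n] f v) atTop
      (𝓝 (⨅ n, (succSum succ)^[n] f v)) := fun v => tendsto_atTop_ciInf (hanti v) (hbdd v)
  refine ⟨fun v => ⨅ n, (succSum succ)^[n] f v, fun v => ?_, fun v => ?_, fun v => ?_, hlim⟩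
  · exact ge_of_tendsto' (hlim v) fun n => iterate_succSum_nonneg h0 n v
  · exact le_of_tendsto' (hlim v) fun n => iterate_succSum_le h n v
  · refine tendsto_nhds_unique ?_ ((tendsto_add_atTop_iff_nat 1).2 (hlim v))
    -- Finite branching allows the limit to pass through the successor sum, and shifting the index
    -- does not change it.
    simp only [iterate_succSum_succ]
    exact tendsto_finsetSum _ fun w _ => hlim w

open Classical in
/-- The successor function that has no successors on `G`. -/
noncomputable def cutSucc (succ : N → Finset N) (G : Set N) (v : N) : Finset N :=
  if v ∈ G then ∅ else succ v

/-- If the mass that never hits `G` vanishes, then a superharmonic function that dominates a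
harmonic function on `G` dominates it everywhere. -/
theorem harmonic_le_of_le_on {G : Set N} {p u K : N → ℝ}
    (hcut : ∀ v, Tendsto (fun n => (succSum (cutSucc succ G))^[n] p v) atTop (𝓝 0))
    (hp : ∀ v, 0 ≤ p v) (hup : ∀ v, u v ≤ p v) (hu : ∀ v, succSum succ u v = u v)
    (hK0 : ∀ v, 0 ≤ K v)
    (hK : ∀ v, succSum succ K v ≤ K v) (hG : ∀ v ∈ G, u v ≤ K v) (v : N) : u v ≤ K v := by
  -- A maximum principle with error term: outside `G` the bound is propagated from the successors;
  -- on `G` it is the assumption. The error is the mass that has survived `n` steps without leaving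
  -- a node of `G`.
  have key : ∀ n v, u v ≤ K v + (succSum (cutSucc succ G))^[n] p v := by
    intro n
    induction n with
    | zero => exact fun v => (hup v).trans (le_add_of_nonneg_left (hK0 v))
    | succ n ih =>
      intro v
      by_cases hv : v ∈ G
      · exact (hG v hv).trans (le_add_of_nonneg_right (iterate_succSum_nonneg hp _ _))
      · rw [iterate_succSum_succ, cutSucc, if_neg hv, ← hu v]
        calc succSum succ u v
            ≤ ∑ w ∈ succ v, (K w + (succSum (cutSucc succ G))^[n] p w) :=
              Finset.sum_le_sum fun w _ => ih w
          _ = succSum succ K v + ∑ w ∈ succ v, (succSum (cutSucc succ G))^[n] p w :=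
              Finset.sum_add_distrib
          _ ≤ _ := by gcongr; exact hK v
  have := (hcut v).const_add (K v)
  rw [add_zero] at this
  exact ge_of_tendsto' this fun n => key n v

/-- The tangent line of the concave function `x ↦ x / (x + 1)` at `k`. -/
theorem div_add_one_le_tangent (k x : ℕ) :
    (x : ℝ) / (x + 1) ≤ k / (k + 1) + (x - k) / (k + 1) ^ 2 := by
  have hx : (0 : ℝ) < x + 1 := by positivity
  have hk : (0 : ℝ) < k + 1 := by positivity
  have h : (k : ℝ) / (k + 1) + (x - k) / (k + 1) ^ 2 - x / (x + 1) =
      (x - k) ^ 2 / ((k + 1) ^ 2 * (x + 1)) := by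
    field_simp; ring
  have : (0 : ℝ) ≤ (x - k) ^ 2 / ((k + 1) ^ 2 * (x + 1)) := by positivity
  linarith

/-- The gap to the tangent is exactly `(x - k) ^ 2 / ((k + 1) ^ 2 * (x + 1))`. For integers `x < k`
the numerator is at least `1` and `x + 1 ≤ k + 1`. -/
theorem div_add_one_le_tangent_sub (k x : ℕ) (hxk : x < k) :
    (x : ℝ) / (x + 1) ≤ k / (k + 1) + (x - k) / (k + 1) ^ 2 - 1 / (k + 1) ^ 3 := by
  have hx : (0 : ℝ) < x + 1 := by positivity
  have hk : (0 : ℝ) < k + 1 := by positivity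
  have h : (k : ℝ) / (k + 1) + (x - k) / (k + 1) ^ 2 - x / (x + 1) =
      (x - k) ^ 2 / ((k + 1) ^ 2 * (x + 1)) := by
    field_simp; ring
  have hxk' : (x : ℝ) + 1 ≤ k := by exact_mod_cast hxk
  have : (1 : ℝ) / (k + 1) ^ 3 ≤ (x - k) ^ 2 / ((k + 1) ^ 2 * (x + 1)) := by
    gcongr
    · nlinarith
    · have : ((k : ℝ) + 1) ^ 3 = (k + 1) ^ 2 * (k + 1) := by ring
      rw [this]
      gcongr
  linarith

/-- A weighted finitely branching graph with an `ℕ`-valued supermartingale `V` that decreases at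
the nodes of `G` with probability at least `ε` loses all its mass, provided that the mass that
avoids `G` vanishes. -/
theorem tendsto_mass_zero {G : Set N} {p : N → ℝ} {V : N → ℕ} {ε : ℝ}
    (hp : ∀ v, 0 < p v) (hsum : ∀ v, (succ v).Nonempty → ∑ w ∈ succ v, p w = p v)
    (hV : ∀ v, (succ v).Nonempty → ∑ w ∈ succ v, p w * V w ≤ p v * V v)
    (hε : 0 < ε) (hG : ∀ v ∈ G, ∃ w ∈ succ v, V w < V v ∧ ε * p v ≤ p w)
    (hcut : ∀ v, Tendsto (fun n => (succSum (cutSucc succ G))^[n] p v) atTop (𝓝 0)) (v : N) :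
    Tendsto (fun n => (succSum succ)^[n] p v) atTop (𝓝 0) := by
  have hp0 : ∀ v, 0 ≤ p v := fun v => (hp v).le
  have hpS : ∀ v, succSum succ p v ≤ p v := by
    intro v
    rcases (succ v).eq_empty_or_nonempty with h | h
    · simpa [succSum, h] using hp0 v
    · exact (hsum v h).le
  have hVS : ∀ v, succSum succ (fun v => p v * V v) v ≤ p v * V v := by
    intro v
    rcases (succ v).eq_empty_or_nonempty with h | h
    · simpa [succSum, h] using mul_nonneg (hp0 v) (Nat.cast_nonneg _)
    · exact hV v h
  set W : N → ℝ := fun v => p v * ((V v : ℝ) / (V v + 1)) with hWdef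
  have hW0 : ∀ v, 0 ≤ W v := fun v => mul_nonneg (hp0 v) (by positivity)
  -- Averaging the tangent at `V v` over the successors gives at most its value at `V v`: the
  -- tangent is affine and increasing, and `V` is a supermartingale.
  have htan : ∀ v, (succ v).Nonempty →
      ∑ w ∈ succ v, p w * ((V v : ℝ) / (V v + 1) + (V w - V v) / (V v + 1) ^ 2) ≤ W v := by
    intro v h
    have : ∑ w ∈ succ v, p w * ((V v : ℝ) / (V v + 1) + (V w - V v) / (V v + 1) ^ 2) =
        p v * ((V v : ℝ) / (V v + 1)) +
          (∑ w ∈ succ v, p w * V w - p v * V v) / (V v + 1) ^ 2 := by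
      rw [← hsum v h, Finset.sum_mul, Finset.sum_mul, ← Finset.sum_sub_distrib, Finset.sum_div,
        ← Finset.sum_add_distrib]
      exact Finset.sum_congr rfl fun w _ => by ring
    rw [this]
    have h2 : (∑ w ∈ succ v, p w * V w - p v * V v) / ((V v : ℝ) + 1) ^ 2 ≤ 0 :=
      div_nonpos_of_nonpos_of_nonneg (sub_nonpos.2 (hV v h)) (by positivity)
    linarith
  have hWS : ∀ v, succSum succ W v ≤ W v := by
    intro v
    rcases (succ v).eq_empty_or_nonempty with h | h
    · simpa [succSum, h] using hW0 v
    · exact (Finset.sum_le_sum fun w _ =>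
        mul_le_mul_of_nonneg_left (div_add_one_le_tangent (V v) (V w)) (hp0 w)).trans (htan v h)
  have hWG : ∀ v ∈ G, succSum succ W v + ε * p v / (V v + 1) ^ 3 ≤ W v := by
    intro v hv
    obtain ⟨w₀, hw₀, hlt, hle⟩ := hG v hv
    have hstrict : W w₀ + ε * p v / (V v + 1) ^ 3 ≤
        p w₀ * ((V v : ℝ) / (V v + 1) + (V w₀ - V v) / (V v + 1) ^ 2) := by
      have h1 := mul_le_mul_of_nonneg_left (div_add_one_le_tangent_sub _ _ hlt) (hp0 w₀)
      have h2 : ε * p v / ((V v : ℝ) + 1) ^ 3 ≤ p w₀ / ((V v : ℝ) + 1) ^ 3 := by gcongr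
      have h3 : p w₀ * (1 / ((V v : ℝ) + 1) ^ 3) = p w₀ / ((V v : ℝ) + 1) ^ 3 := by ring
      rw [mul_sub, h3] at h1
      simp only [hWdef]
      linarith
    refine le_trans ?_ (htan v ⟨w₀, hw₀⟩)
    classical
    rw [succSum, ← Finset.add_sum_erase _ _ hw₀, ← Finset.add_sum_erase _ _ hw₀]
    have := Finset.sum_le_sum (s := (succ v).erase w₀) fun w _ =>
        mul_le_mul_of_nonneg_left (div_add_one_le_tangent (V v) (V w)) (hp0 w)
    linarith
  -- `u v` is the mass below `v` that never ends in a leaf; the goal is `u v = 0`.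
  obtain ⟨u, hu0, hup, hu, hulim⟩ := exists_harmonic_limit hp0 hpS
  obtain ⟨h, hh0, hhW, hh, hhlim⟩ := exists_harmonic_limit hW0 hWS
  -- Riesz decomposition of `W` into its harmonic part `h` and the potential `H`. The explicit
  -- coefficients match `iterate_succSum_add_mul`.
  set H : N → ℝ := fun v => 1 * W v + (-1) * h v with hHdef
  have hH0 : ∀ v, 0 ≤ H v := fun v => by have := hhW v; simp only [hHdef]; linarith
  have hHS : ∀ v, succSum succ H v = succSum succ W v - h v := fun v => by
    have := iterate_succSum_add_mul (succ := succ) 1 (-1) W h 1 v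
    simp only [Function.iterate_one, hh] at this
    rw [hHdef, this]; ring
  have hHlim : ∀ v, Tendsto (fun n => (succSum succ)^[n] H v) atTop (𝓝 0) := by
    intro v
    have := (hhlim v).sub_const (h v)
    rw [sub_self] at this
    refine this.congr fun n => ?_
    rw [hHdef, iterate_succSum_add_mul, iterate_succSum_of_harmonic hh]; ring
  have hbound : ∀ M : ℕ, 0 < M → ∀ v, u v ≤ p v * V v / M := by
    intro M hM v
    have hM' : (0 : ℝ) < M := by exact_mod_cast hM
    set C : ℝ := ((M : ℝ) + 1) ^ 3 / ε with hC
    have hC0 : 0 ≤ C := by positivity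
    -- On `G` the first summand dominates `p` if `V v ≤ M`, and the second does if `V v > M`.
    have hK : ∀ v, u v ≤ C * H v + (M : ℝ)⁻¹ * (p v * V v) := by
      refine harmonic_le_of_le_on hcut hp0 hup hu (fun v => ?_) (fun v => ?_) fun v hv => ?_
      · have := hH0 v
        have := hp0 v
        positivity
      · have := iterate_succSum_add_mul (succ := succ) C (M : ℝ)⁻¹ H (fun v => p v * V v) 1 v
        simp only [Function.iterate_one] at this
        rw [this, hHS]
        have h1 := hWS v
        have h2 := hVS v
        gcongr
        simp only [hHdef]; linarith
      · refine (hup v).trans ?_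
        rcases le_or_gt (V v) M with hVM | hVM
        · have h1 := hWG v hv
          -- Since `h` is harmonic and below `W`, it is also below the successor sum of `W`. So the
          -- whole loss of `W` at `v` is contained in `H v`.
          have h2 : h v ≤ succSum succ W v := (hh v).symm.le.trans (succSum_mono hhW v)
          have h3 : ε * p v / ((M : ℝ) + 1) ^ 3 ≤ ε * p v / ((V v : ℝ) + 1) ^ 3 := by
            have := hp0 v
            gcongr
          have h4 : ε * p v / ((M : ℝ) + 1) ^ 3 ≤ H v := by simp only [hHdef]; linarith
          have h5 : p v = C * (ε * p v / ((M : ℝ) + 1) ^ 3) := by rw [hC]; field_simp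
          have h6 : 0 ≤ (M : ℝ)⁻¹ * (p v * V v) := by have := hp0 v; positivity
          have h7 := mul_le_mul_of_nonneg_left h4 hC0
          linarith
        · have h1 : (M : ℝ) ≤ V v := by exact_mod_cast hVM.le
          have h2 : p v = (M : ℝ)⁻¹ * (p v * M) := by field_simp
          have h3 : (M : ℝ)⁻¹ * (p v * M) ≤ (M : ℝ)⁻¹ * (p v * V v) := by
            have := hp0 v
            gcongr
          have h4 := mul_nonneg hC0 (hH0 v)
          linarith
    have hlim : Tendsto (fun n => C * (succSum succ)^[n] H v + (M : ℝ)⁻¹ * (p v * V v)) atTop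
        (𝓝 (C * 0 + (M : ℝ)⁻¹ * (p v * V v))) := ((hHlim v).const_mul C).add_const _
    -- Iterating `hK` fixes the harmonic `u`, sends the potential to `0` and does not increase the
    -- superharmonic Markov term.
    have := ge_of_tendsto' hlim (b := u v) fun n => by
      rw [← iterate_succSum_of_harmonic hu n v]
      refine (iterate_succSum_mono hK n v).trans ?_
      rw [iterate_succSum_add_mul]
      have := iterate_succSum_le hVS n v
      gcongr
    rw [mul_zero, zero_add] at this
    rwa [div_eq_inv_mul]
  have hu_zero : u v = 0 := by
    refine le_antisymm ?_ (hu0 v)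
    have := tendsto_const_div_atTop_nhds_zero_nat (p v * V v)
    refine ge_of_tendsto this ?_
    filter_upwards [eventually_gt_atTop 0] with M hM using hbound M hM v
  exact hu_zero ▸ hulim v

end SuccSum

/-! ## The mass of the leaves of a tree -/

section Levels

variable {N : Type*} {root : N} {succ : N → Finset N}

open Classical in
/-- The nodes at distance `n` from the root. -/
noncomputable def level (root : N) (succ : N → Finset N) : ℕ → Finset N
  | 0 => {root}
  | n + 1 => (level root succ n).biUnion succ

theorem mem_level_succ {n : ℕ} {w : N} :
    w ∈ level root succ (n + 1) ↔ ∃ v ∈ level root succ n, w ∈ succ v := by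
  simp [level]

theorem eq_of_mem_succ (hroot : ∀ v, root ∉ succ v)
    (hpred : ∀ w, w ≠ root → ∃! v, w ∈ succ v) {v v' w : N} (h : w ∈ succ v)
    (h' : w ∈ succ v') : v = v' :=
  (hpred w fun e => hroot v (e ▸ h)).unique h h'

/-- Successor sets of distinct nodes are disjoint because predecessors are unique, so summing over
one more level amounts to replacing `f` by its successor sum. -/
theorem sum_level (hroot : ∀ v, root ∉ succ v) (hpred : ∀ w, w ≠ root → ∃! v, w ∈ succ v)
    (f : N → ℝ) (n : ℕ) : ∑ v ∈ level root succ n, f v = (succSum succ)^[n] f root := by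
  classical
  induction n generalizing f with
  | zero => simp [level]
  | succ n ih =>
    rw [Function.iterate_succ_apply, ← ih, level, Finset.sum_biUnion]
    · rfl
    · intro v _ v' _ hne
      exact Finset.disjoint_left.2 fun w h h' => hne (eq_of_mem_succ hroot hpred h h')

theorem level_unique (hroot : ∀ v, root ∉ succ v)
    (hpred : ∀ w, w ≠ root → ∃! v, w ∈ succ v) {m n : ℕ} {v : N}
    (hm : v ∈ level root succ m) (hn : v ∈ level root succ n) : m = n := by
  induction m generalizing n v with
  | zero =>
    cases n with
    | zero => rfl
    | succ n =>
      obtain ⟨x, -, hx⟩ := mem_level_succ.1 hn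
      rw [level, Finset.mem_singleton] at hm
      exact (hroot x (hm ▸ hx)).elim
  | succ m ih =>
    obtain ⟨x, hxm, hx⟩ := mem_level_succ.1 hm
    cases n with
    | zero =>
      rw [level, Finset.mem_singleton] at hn
      exact (hroot x (hn ▸ hx)).elim
    | succ n =>
      obtain ⟨y, hyn, hy⟩ := mem_level_succ.1 hn
      rw [ih hxm (eq_of_mem_succ hroot hpred hy hx ▸ hyn)]

theorem exists_mem_level (hreach : ∀ v, Relation.ReflTransGen (fun x y => y ∈ succ x) root v)
    (v : N) : ∃ n, v ∈ level root succ n := by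
  induction hreach v with
  | refl => exact ⟨0, by simp [level]⟩
  | tail _ hbc ih =>
    obtain ⟨n, hn⟩ := ih
    exact ⟨n + 1, mem_level_succ.2 ⟨_, hn, hbc⟩⟩

/-- The leaves of a probability tree have total mass one iff the mass of its levels vanishes. -/
theorem tsum_leaves_eq_one_iff (hroot : ∀ v, root ∉ succ v)
    (hpred : ∀ w, w ≠ root → ∃! v, w ∈ succ v)
    (hreach : ∀ v, Relation.ReflTransGen (fun x y => y ∈ succ x) root v)
    {p : N → ℝ} (hp : ∀ v, 0 < p v) (hp1 : p root = 1)
    (hsum : ∀ v, (succ v).Nonempty → ∑ w ∈ succ v, p w = p v) :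
    ∑' v : {v : N // succ v = ∅}, ENNReal.ofReal (p v) = 1 ↔
      Tendsto (fun n => (succSum succ)^[n] p root) atTop (𝓝 0) := by
  classical
  -- The mass lost at a node is `p v` at a leaf and `0` at an inner node. The leaf sum thus becomes
  -- a sum over all nodes, which telescopes over the levels.
  set g : N → ℝ := fun v => p v - succSum succ p v with hg
  have hgleaf : ∀ v, succ v = ∅ → g v = p v := fun v h => by simp [hg, succSum, h]
  have hginner : ∀ v, succ v ≠ ∅ → g v = 0 := fun v h =>
    sub_eq_zero.2 (hsum v (Finset.nonempty_iff_ne_empty.2 h)).symm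
  have hg0 : ∀ v, 0 ≤ g v := fun v => by
    by_cases h : succ v = ∅
    · rw [hgleaf v h]; exact (hp v).le
    · rw [hginner v h]
  have hleaf : ∑' v : {v : N // succ v = ∅}, ENNReal.ofReal (p v) =
      ∑' v, ENNReal.ofReal (g v) := by
    refine (tsum_subtype {v | succ v = ∅} fun v => ENNReal.ofReal (p v)).trans
      (tsum_congr fun v => ?_)
    by_cases h : succ v = ∅
    · rw [Set.indicator_of_mem (by exact h), hgleaf v h]
    · rw [Set.indicator_of_notMem (by exact h), hginner v h, ENNReal.ofReal_zero]
  set B : ℕ → Finset N := fun n => (Finset.range n).biUnion (level root succ) with hB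
  have hBmono : Monotone B := fun m n h =>
    Finset.biUnion_subset_biUnion_of_subset_left _ (Finset.range_mono h)
  have hBtop : Tendsto B atTop atTop := by
    refine tendsto_atTop_finset_of_monotone hBmono fun v => ?_
    obtain ⟨n, hn⟩ := exists_mem_level hreach v
    exact ⟨n + 1, Finset.mem_biUnion.2 ⟨n, Finset.self_mem_range_succ n, hn⟩⟩
  have hBsum : ∀ n, ∑ v ∈ B n, g v = 1 - (succSum succ)^[n] p root := by
    intro n
    rw [hB, Finset.sum_biUnion fun i _ j _ hij => Finset.disjoint_left.2 fun v hi hj =>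
      hij (level_unique hroot hpred hi hj)]
    have : ∀ i, ∑ v ∈ level root succ i, g v =
        (succSum succ)^[i] p root - (succSum succ)^[i + 1] p root := fun i => by
      rw [hg, Finset.sum_sub_distrib, sum_level hroot hpred, sum_level hroot hpred,
        ← Function.iterate_succ_apply]
    simp only [this]
    rw [Finset.sum_range_sub']
    simp [hp1]
  have hlim : Tendsto (fun n => ENNReal.ofReal (1 - (succSum succ)^[n] p root)) atTop
      (𝓝 (∑' v, ENNReal.ofReal (g v))) := by
    refine (ENNReal.summable.hasSum.comp hBtop).congr fun n => ?_
    rw [Function.comp_apply, ← ENNReal.ofReal_sum_of_nonneg fun v _ => hg0 v, hBsum]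
  have hle : ∀ n, 0 ≤ 1 - (succSum succ)^[n] p root := fun n =>
    hBsum n ▸ Finset.sum_nonneg fun v _ => hg0 v
  rw [hleaf]
  constructor
  · intro h
    rw [h] at hlim
    have h1 := (ENNReal.tendsto_toReal ENNReal.one_ne_top).comp hlim
    have h2 := h1.const_sub 1
    rw [ENNReal.toReal_one, sub_self] at h2
    refine h2.congr fun n => ?_
    rw [Function.comp_apply, ENNReal.toReal_ofReal (hle n)]; ring
  · intro h
    have h1 := ENNReal.tendsto_ofReal (h.const_sub 1)
    rw [sub_zero, ENNReal.ofReal_one] at h1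
    exact tendsto_nhds_unique hlim h1

/-- A cycle through a node passes through its unique predecessor, hence, going up the path, through
the root, which has none. This keeps the root of a cut subtree free of predecessors. -/
theorem not_transGen_self (hroot : ∀ v, root ∉ succ v)
    (hpred : ∀ w, w ≠ root → ∃! v, w ∈ succ v)
    (hreach : ∀ v, Relation.ReflTransGen (fun x y => y ∈ succ x) root v) (v : N) :
    ¬ Relation.TransGen (fun x y => y ∈ succ x) v v := by
  induction hreach v with
  | refl =>
    intro h
    obtain ⟨z, -, hz⟩ := Relation.TransGen.tail'_iff.1 h
    exact hroot z hz
  | @tail b c _ hbc ih =>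
    intro h
    obtain ⟨z, hcz, hz⟩ := Relation.TransGen.tail'_iff.1 h
    obtain rfl := eq_of_mem_succ hroot hpred hz hbc
    exact ih (Relation.TransGen.head' hbc hcz)

end Levels

/-! ## Polynomial interpretations -/

section Poly

universe u v

variable {F : Signature.{u}} {X : Type v} {I : PolyInterp F}

/-- A monomial contains the chosen variable with exponent `0` or `1`, so it contributes to the
constant or to the slope. -/
theorem eval_update_affine {ι : Type*} [Fintype ι] [DecidableEq ι] (p : MvPolynomial ι ℕ)
    (hp : ∀ m ∈ p.support, ∀ i, m i ≤ 1) (f : ι → ℕ) (i : ι) :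
    ∃ a b : ℕ, ∀ x, MvPolynomial.eval (Function.update f i x) p = a + b * x := by
  have hterm : ∀ m : ι →₀ ℕ, ∃ a b : ℕ, m ∈ p.support → ∀ x,
      p.coeff m * ∏ j, Function.update f i x j ^ m j = a + b * x := by
    intro m
    by_cases hm : m ∈ p.support
    · have hprod : ∀ x, ∏ j, Function.update f i x j ^ m j =
          x ^ m i * ∏ j ∈ Finset.univ.erase i, f j ^ m j := by
        intro x
        rw [← Finset.mul_prod_erase _ _ (Finset.mem_univ i), Function.update_self]
        congr 1
        refine Finset.prod_congr rfl fun j hj => ?_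
        rw [Function.update_of_ne (Finset.ne_of_mem_erase hj)]
      have := hp m hm i
      interval_cases h : m i
      · exact ⟨p.coeff m * ∏ j ∈ Finset.univ.erase i, f j ^ m j, 0, fun _ x => by
          rw [hprod]; ring⟩
      · exact ⟨0, p.coeff m * ∏ j ∈ Finset.univ.erase i, f j ^ m j, fun _ x => by
          rw [hprod]; ring⟩
    · exact ⟨0, 0, fun h => (hm h).elim⟩
  choose a b hab using hterm
  refine ⟨∑ m ∈ p.support, a m, ∑ m ∈ p.support, b m, fun x => ?_⟩
  rw [MvPolynomial.eval_eq', Finset.sum_mul, ← Finset.sum_add_distrib]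
  exact Finset.sum_congr rfl fun m hm => hab m hm x

theorem eval_subst (α : X → ℕ) (σ : X → Term F X) (t : Term F X) :
    I.eval α (t.subst σ) = I.eval (fun x => I.eval α (σ x)) t := by
  induction t with
  | var x => simp [Term.subst, PolyInterp.eval]
  | app g ts ih => simp only [Term.subst, PolyInterp.eval, ih]

theorem replaceAt_subAt {s u : Term F X} {π : List ℕ} (h : s.subAt π = some u) :
    s.replaceAt π u = s := by
  induction π generalizing s with
  | nil => simpa [Term.subAt, Term.replaceAt] using h.symm
  | cons k π ih =>
    cases s with
    | var x => simp [Term.replaceAt]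
    | app g ts =>
      simp only [Term.subAt] at h
      split at h
      · simp only [Term.replaceAt, Term.app.injEq, heq_eq_eq, true_and]
        funext j
        split
        · next hk hj => subst hj; exact ih h
        · rfl
      · cases h

/-- Affine maps compose along the position. The coefficients do not depend on the inserted term, so
the map commutes with expectations; being natural numbers, they also make it monotone. -/
theorem eval_replaceAt_affine (hlin : I.Multilinear) (α : X → ℕ) (s : Term F X) (π : List ℕ) :
    ∃ a b : ℕ, s.subAt π ≠ none → ∀ t, I.eval α (s.replaceAt π t) = a + b * I.eval α t := by
  induction π generalizing s with
  | nil => exact ⟨0, 1, fun _ t => by simp [Term.replaceAt]⟩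
  | cons k π ih =>
    cases s with
    | var x => exact ⟨0, 0, fun h => (h rfl).elim⟩
    | app g ts =>
      by_cases hk : k < g.arity
      · obtain ⟨a, b, hab⟩ := ih (ts ⟨k, hk⟩)
        obtain ⟨a', b', hab'⟩ := eval_update_affine (I.poly g) (hlin g)
          (fun j => I.eval α (ts j)) ⟨k, hk⟩
        refine ⟨a' + b' * a, b' * b, fun h t => ?_⟩
        rw [Term.subAt, dif_pos hk] at h
        have : (fun j : Fin g.arity =>
              I.eval α (if (j : ℕ) = k then (ts j).replaceAt π t else ts j)) =
            Function.update (fun j => I.eval α (ts j)) ⟨k, hk⟩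
              (I.eval α ((ts ⟨k, hk⟩).replaceAt π t)) := by
          funext j
          by_cases hj : j = ⟨k, hk⟩
          · subst hj; simp
          · rw [Function.update_of_ne hj, if_neg fun e => hj (Fin.ext e)]
        simp only [Term.replaceAt, PolyInterp.eval]
        rw [this, hab', hab h]
        ring
      · exact ⟨0, 0, fun h => (h (by rw [Term.subAt, dif_neg hk])).elim⟩

theorem eval_com (hadd : I.ComAdditive) (α : X → ℕ) (n : ℕ) (ts : Fin n → Term F X) :
    I.eval α (.app (.com n) ts) = ∑ i, I.eval α (ts i) := by
  change MvPolynomial.eval (fun i => I.eval α (ts i)) (I.poly (.com n)) = _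
  rw [hadd]
  exact (map_sum (MvPolynomial.eval fun i => I.eval α (ts i)) _ _).trans
    (Finset.sum_congr rfl fun i _ => MvPolynomial.eval_X i)

/-- Compound additivity makes the value depend on the content alone, so identifying terms with equal
content is harmless. -/
theorem sum_map_cont (hadd : I.ComAdditive) (α : X → ℕ) (t : Term F X) :
    (t.cont.map (I.eval α)).sum = I.eval α t := by
  induction t with
  | var x => simp [Term.cont]
  | app g ts ih =>
    cases g with
    | com n =>
      refine Eq.trans ?_ (eval_com hadd α n ts).symm
      rw [Term.cont]
      refine (map_sum ((Multiset.sumAddMonoidHom).comp (Multiset.mapAddMonoidHom (I.eval α)))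
        _ _).trans ?_
      exact Finset.sum_congr rfl fun i _ => ih i
    | con c => simp [Term.cont]
    | defd f => simp [Term.cont]
    | tup f => simp [Term.cont]

theorem eval_eq_of_cont_eq (hadd : I.ComAdditive) (α : X → ℕ) {n : ℕ} {s : Fin n → Term F X}
    {a : Term F X} (h : a.cont = Finset.univ.val.map s) :
    I.eval α a = ∑ i, I.eval α (s i) := by
  rw [← sum_map_cont hadd, h, Multiset.map_map]; rfl

/-- The expected value of a function on a weighted multiset. -/
noncomputable def expectation {A : Type*} (M : Multiset (ℝ × A)) (e : ℝ × A → ℝ) : ℝ :=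
  (M.map fun x => x.1 * e x).sum

theorem expectation_affine {A : Type*} (μ : FDist A) (a b : ℝ) (e : ℝ × A → ℝ) :
    expectation μ.weights (fun x => a + b * e x) = a + b * expectation μ.weights e := by
  have : ∀ M : Multiset (ℝ × A), expectation M (fun x => a + b * e x) =
      a * (M.map Prod.fst).sum + b * expectation M e := by
    intro M
    induction M using Multiset.induction with
    | empty => simp [expectation]
    | cons x M ih => simp only [expectation, Multiset.map_cons, Multiset.sum_cons] at ih ⊢
                     rw [ih]; ring
  rw [this, μ.sum_eq_one, mul_one]

theorem expectation_sum {A ι : Type*} (s : Finset ι) (M : Multiset (ℝ × A))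
    (e : ι → ℝ × A → ℝ) :
    expectation M (fun x => ∑ i ∈ s, e i x) = ∑ i ∈ s, expectation M (e i) := by
  induction M using Multiset.induction with
  | empty => simp [expectation]
  | cons x M ih =>
    simp only [expectation, Multiset.map_cons, Multiset.sum_cons] at ih ⊢
    rw [ih, Finset.sum_add_distrib, Finset.mul_sum]

/-- The expected value of the interpretation of the terms of a weighted multiset. -/
noncomputable def expectedEval (I : PolyInterp F) (α : X → ℕ) (ν : Multiset (ℝ × Term F X)) : ℝ :=
  expectation ν fun x => (I.eval α x.2 : ℝ)

theorem ContEq.expectedEval_eq (hadd : I.ComAdditive) (α : X → ℕ)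
    {μ ν : Multiset (ℝ × Term F X)} (h : ContEq μ ν) :
    expectedEval I α μ = expectedEval I α ν := by
  have := congrArg (fun M => (M.map fun x : ℝ × Multiset (Term F X) =>
    x.1 * (((x.2.map (I.eval α)).sum : ℕ) : ℝ)).sum) h
  simp only [Multiset.map_map, Function.comp_def, sum_map_cont hadd] at this
  exact this

theorem ContEq.sum_fst_eq {μ ν : Multiset (ℝ × Term F X)} (h : ContEq μ ν) :
    (μ.map Prod.fst).sum = (ν.map Prod.fst).sum := by
  have := congrArg (fun M => (M.map fun x : ℝ × Multiset (Term F X) => x.1).sum) h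
  simpa only [Multiset.map_map, Function.comp_def] using this

/-- Linearity of expectation reduces the bound to single arguments, although one random choice acts
on all of them simultaneously. -/
theorem expectedEval_com_le (hadd : I.ComAdditive) (α : X → ℕ) {A : Type*}
    (M : Multiset (ℝ × A)) {n : ℕ} {s : Fin n → Term F X} (t : Fin n → ℝ × A → Term F X)
    (h : ∀ i, expectation M (fun x => (I.eval α (t i x) : ℝ)) ≤ I.eval α (s i)) :
    expectedEval I α (M.map fun x => (x.1, .app (.com n) fun i => t i x)) ≤
      ((∑ i, I.eval α (s i) : ℕ) : ℝ) := by
  have : expectedEval I α (M.map fun x => (x.1, .app (.com n) fun i => t i x)) =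
      expectation M fun x => ∑ i, (I.eval α (t i x) : ℝ) := by
    simp only [expectedEval, expectation, Multiset.map_map, Function.comp_def]
    congr 1
    refine Multiset.map_congr rfl fun x _ => ?_
    exact congrArg (x.1 * ·) ((congrArg Nat.cast (eval_com hadd α n fun i => t i x)).trans
      (Nat.cast_sum _ _))
  rw [this, expectation_sum, Nat.cast_sum]
  exact Finset.sum_le_sum fun i _ => h i

/-! ### Interpretations along rewrite steps -/

/-- Replacing a redex does not increase the expected value. -/
theorem expectation_replaceAt_le (hlin : I.Multilinear) (α : X → ℕ) {A : Type*} (μ : FDist A)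
    (r : A → Term F X) (σ : X → Term F X) {ℓ s : Term F X} {π : List ℕ}
    (hs : s.subAt π = some (ℓ.subst σ))
    (hρ : I.ExpectedGe ⟨ℓ, μ.map r⟩) :
    expectation μ.weights (fun x => (I.eval α (s.replaceAt π ((r x.2).subst σ)) : ℝ)) ≤
      I.eval α s := by
  obtain ⟨a, b, hab⟩ := eval_replaceAt_affine hlin α s π
  have hab := hab (by simp [hs])
  -- Reading `s` as the result of inserting its own redex puts both sides into the same affine form.
  conv_rhs => rw [← replaceAt_subAt hs]
  simp only [hab, Nat.cast_add, Nat.cast_mul]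
  rw [expectation_affine]
  have := hρ fun x => I.eval α (σ x)
  simp only [FDist.map, Multiset.map_map, Function.comp_def] at this
  rw [eval_subst]
  simp only [eval_subst, expectation]
  gcongr

theorem expectation_const {A : Type*} (μ : FDist A) (a : ℝ) :
    expectation μ.weights (fun _ => a) = a := by
  simpa using expectation_affine μ a 0 fun _ => 0

theorem expectation_optReplace_le (hlin : I.Multilinear) (α : X → ℕ) {A : Type*} (μ : FDist A)
    (r : A → Term F X) (σ : X → Term F X) {ℓ s : Term F X} {o : Option (List ℕ)}
    (hs : ∀ τ, o = some τ → s.subAt τ = some (ℓ.subst σ) ∧ I.ExpectedGe ⟨ℓ, μ.map r⟩) :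
    expectation μ.weights (fun x => (I.eval α (optReplace s o ((r x.2).subst σ)) : ℝ)) ≤
      I.eval α s := by
  cases o with
  | none => exact (expectation_const μ (I.eval α s : ℝ)).le
  | some τ => exact expectation_replaceAt_le hlin α μ r σ (hs τ rfl).1 (hs τ rfl).2

theorem FDist.map_id' {A : Type*} (μ : FDist A) : μ.map (fun a => a) = μ := by
  ext1; simp [FDist.map]

theorem RuleStep.expectedEval_le (hlin : I.Multilinear) (hadd : I.ComAdditive)
    {S : Set (ProbRule F X)} (h1 : ∀ ρ ∈ S, I.ExpectedGe ρ) (α : X → ℕ) {a : Term F X}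
    {ν : Multiset (ℝ × Term F X)} (h : RuleStep S a ν) :
    expectedEval I α ν ≤ I.eval α a := by
  obtain ⟨n, s, i, ρ, π, σ, c, ha, hρ, hπ, -, hc, hν⟩ := h
  have hge : I.ExpectedGe ⟨ρ.lhs, ρ.rhs.map fun r => r⟩ := by
    rw [FDist.map_id']; exact h1 ρ hρ
  rw [hν.expectedEval_eq hadd, eval_eq_of_cont_eq hadd α ha]
  refine expectedEval_com_le hadd α ρ.rhs.weights (fun i' x => if i' = i then
    (s i).replaceAt π (x.2.subst σ) else optReplace (s i') (c i') (x.2.subst σ)) fun i' => ?_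
  by_cases hi : i' = i
  · subst hi
    simp only [if_true]
    exact expectation_replaceAt_le hlin α ρ.rhs (fun r => r) σ hπ hge
  · simp only [if_neg hi]
    exact expectation_optReplace_le hlin α ρ.rhs (fun r => r) σ fun τ hτ => ⟨hc i' hi τ hτ, hge⟩

theorem TupleStep.expectedEval_le (hlin : I.Multilinear) (hadd : I.ComAdditive)
    {P : Set (DepTuple F X)} {S : Set (ProbRule F X)} (h1 : ∀ ρ ∈ S, I.ExpectedGe ρ)
    (h2 : ∀ δ ∈ P, I.ExpectedGe δ.proj₁) (α : X → ℕ) {a : Term F X}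
    {ν : Multiset (ℝ × Term F X)} (h : TupleStep P S a ν) :
    expectedEval I α ν ≤ I.eval α a := by
  obtain ⟨n, s, i, δ, σ, c, ha, hδ, hs, -, hc, hν⟩ := h
  rw [hν.expectedEval_eq hadd, eval_eq_of_cont_eq hadd α ha]
  refine expectedEval_com_le hadd α δ.rhs.weights (fun i' x => if i' = i then
    x.2.1.subst σ else optReplace (s i') (c i') (x.2.2.subst σ)) fun i' => ?_
  by_cases hi : i' = i
  · subst hi
    simp only [if_true]
    -- The tuple is applied at the root, which is replacement at the empty position.
    have h := expectation_replaceAt_le hlin α δ.rhs Prod.fst σ (ℓ := δ.lhs.sharp)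
      (s := δ.lhs.sharp.subst σ) (π := []) (by simp only [Term.subAt]) (h2 δ hδ)
    simp only [Term.replaceAt] at h
    rw [hs]
    exact h
  · simp only [if_neg hi]
    exact expectation_optReplace_le hlin α δ.rhs Prod.snd σ fun τ hτ =>
      ⟨(hc i' hi τ hτ).1, h1 _ (hc i' hi τ hτ).2⟩

theorem eval_optReplace_le (hlin : I.Multilinear) (α : X → ℕ) (σ : X → Term F X)
    {ℓ r s : Term F X} {o : Option (List ℕ)}
    (hs : ∀ τ, o = some τ → s.subAt τ = some (ℓ.subst σ) ∧ I.Ge ℓ r) :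
    I.eval α (optReplace s o (r.subst σ)) ≤ I.eval α s := by
  cases o with
  | none => exact le_rfl
  | some τ =>
    obtain ⟨hτ, hge⟩ := hs τ rfl
    obtain ⟨a, b, hab⟩ := eval_replaceAt_affine hlin α s τ
    have hab := hab (by simp [hτ])
    conv_rhs => rw [← replaceAt_subAt hτ]
    rw [optReplace, hab, hab, eval_subst, eval_subst]
    gcongr
    exact hge _

/-- A step with a strictly decreasing dependency tuple decreases the value with at least the
probability of the decreasing right-hand side. -/
theorem TupleStep.exists_eval_lt (hlin : I.Multilinear) (hadd : I.ComAdditive)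
    {P : Set (DepTuple F X)} {S : Set (ProbRule F X)} {ε : ℝ}
    (h3 : ∀ δ ∈ P, ∃ y ∈ δ.rhs.weights, ε ≤ y.1 ∧ I.Gt δ.lhs.sharp y.2.1 ∧
      (δ.proj₂ ∈ S → I.Ge δ.lhs y.2.2)) (α : X → ℕ) {a : Term F X}
    {ν : Multiset (ℝ × Term F X)} (h : TupleStep P S a ν) :
    ∃ x ∈ ν, ε ≤ x.1 ∧ I.eval α x.2 < I.eval α a := by
  obtain ⟨n, s, i, δ, σ, c, ha, hδ, hs, -, hc, hν⟩ := h
  obtain ⟨y, hy, hεy, hgt, hge⟩ := h3 δ hδ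
  -- The distribution is known only up to contents, so the decreasing outcome is transported through
  -- `cont`, which preserves its probability and value.
  have hmem := Multiset.mem_map_of_mem (fun x : ℝ × Term F X => (x.1, x.2.cont))
    (Multiset.mem_map_of_mem (fun x : ℝ × (Term F X × Term F X) => (x.1,
      (.app (.com n) fun i' : Fin n => if i' = i then x.2.1.subst σ
        else optReplace (s i') (c i') (x.2.2.subst σ) : Term F X))) hy)
  rw [← hν] at hmem
  obtain ⟨x, hx, hxy⟩ := Multiset.mem_map.1 hmem
  simp only [Prod.mk.injEq] at hxy
  refine ⟨x, hx, hxy.1 ▸ hεy, ?_⟩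
  rw [← sum_map_cont hadd, hxy.2, sum_map_cont hadd, eval_com hadd, eval_eq_of_cont_eq hadd α ha]
  refine Finset.sum_lt_sum (fun i' _ => ?_) ⟨i, Finset.mem_univ i, ?_⟩
  · by_cases hi : i' = i
    · subst hi
      rw [if_pos rfl, hs, eval_subst, eval_subst]
      exact (hgt _).le
    · rw [if_neg hi]
      exact eval_optReplace_le hlin α σ fun τ hτ => ⟨(hc i' hi τ hτ).1, hge (hc i' hi τ hτ).2⟩
  · rw [if_pos rfl, hs, eval_subst, eval_subst]
    exact hgt _

theorem TupleStep.sum_fst_eq_one {P : Set (DepTuple F X)} {S : Set (ProbRule F X)}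
    {a : Term F X} {ν : Multiset (ℝ × Term F X)} (h : TupleStep P S a ν) :
    (ν.map Prod.fst).sum = 1 := by
  obtain ⟨n, s, i, δ, σ, c, -, -, -, -, -, hν⟩ := h
  rw [hν.sum_fst_eq, Multiset.map_map]
  exact δ.rhs.sum_eq_one

theorem RuleStep.sum_fst_eq_one {S : Set (ProbRule F X)}
    {a : Term F X} {ν : Multiset (ℝ × Term F X)} (h : RuleStep S a ν) :
    (ν.map Prod.fst).sum = 1 := by
  obtain ⟨n, s, i, ρ, π, σ, c, -, -, -, -, -, hν⟩ := h
  rw [hν.sum_fst_eq, Multiset.map_map]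
  exact ρ.rhs.sum_eq_one

theorem TupleStep.mono {P P' : Set (DepTuple F X)} {S : Set (ProbRule F X)} (hP : P ⊆ P')
    {a : Term F X} {ν : Multiset (ℝ × Term F X)} (h : TupleStep P S a ν) :
    TupleStep P' S a ν := by
  obtain ⟨n, s, i, δ, σ, c, ha, hδ, h⟩ := h
  exact ⟨n, s, i, δ, σ, c, ha, hP hδ, h⟩

theorem TupleStep.of_union {P P' : Set (DepTuple F X)} {S : Set (ProbRule F X)}
    {a : Term F X} {ν : Multiset (ℝ × Term F X)} (h : TupleStep (P ∪ P') S a ν) :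
    TupleStep P S a ν ∨ TupleStep P' S a ν := by
  obtain ⟨n, s, i, δ, σ, c, ha, hδ | hδ, h⟩ := h
  · exact .inl ⟨n, s, i, δ, σ, c, ha, hδ, h⟩
  · exact .inr ⟨n, s, i, δ, σ, c, ha, hδ, h⟩

end Poly

/-! ## Chain trees -/

namespace ChainTree

universe u v

variable {F : Signature.{u}} {X : Type v} {Q : DPProblem F X} (T : ChainTree Q)

/-- The multi-distribution of the labels of the successors of a node. -/
noncomputable def succDist (v : T.Node) : Multiset (ℝ × Term F X) :=
  (T.succ v).val.map fun w => (T.prob w / T.prob v, T.label w)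

theorem sum_prob_succ (v : T.Node) (hv : (T.succ v).Nonempty) :
    ∑ w ∈ T.succ v, T.prob w = T.prob v := by
  have h : ((T.succDist v).map Prod.fst).sum = 1 := by
    by_cases hP : v ∈ T.PNode
    · exact (T.tuple_step v hP).sum_fst_eq_one
    · exact (T.rule_step v hP hv).sum_fst_eq_one
  rw [succDist, Multiset.map_map] at h
  have h' : ∑ w ∈ T.succ v, T.prob w / T.prob v = 1 := h
  rwa [← Finset.sum_div, div_eq_one_iff_eq (T.prob_pos v).ne'] at h'

theorem sum_prob_mul_eval_succ_le {I : PolyInterp F} (hlin : I.Multilinear)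
    (hadd : I.ComAdditive) (h1 : ∀ ρ ∈ Q.S, I.ExpectedGe ρ)
    (h2 : ∀ δ ∈ Q.P, I.ExpectedGe δ.proj₁) (α : X → ℕ) (v : T.Node)
    (hv : (T.succ v).Nonempty) :
    ∑ w ∈ T.succ v, T.prob w * I.eval α (T.label w) ≤ T.prob v * I.eval α (T.label v) := by
  have h : expectedEval I α (T.succDist v) ≤ I.eval α (T.label v) := by
    by_cases hP : v ∈ T.PNode
    · exact (T.tuple_step v hP).expectedEval_le hlin hadd h1 h2 α
    · exact (T.rule_step v hP hv).expectedEval_le hlin hadd h1 α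
  rw [expectedEval, expectation, succDist, Multiset.map_map] at h
  have h' : ∑ w ∈ T.succ v, T.prob w / T.prob v * I.eval α (T.label w) ≤
      I.eval α (T.label v) := h
  have hpos := T.prob_pos v
  calc ∑ w ∈ T.succ v, T.prob w * (I.eval α (T.label w) : ℝ)
      = T.prob v * ∑ w ∈ T.succ v, T.prob w / T.prob v * I.eval α (T.label w) := by
        rw [Finset.mul_sum]
        exact Finset.sum_congr rfl fun w _ => by field_simp
    _ ≤ _ := by gcongr

theorem leafProb_eq_one_iff :
    T.leafProb = 1 ↔ Tendsto (fun n => (succSum T.succ)^[n] T.prob T.root) atTop (𝓝 0) :=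
  tsum_leaves_eq_one_iff T.root_not_mem T.unique_pred T.reachable T.prob_pos T.prob_root
    T.sum_prob_succ

theorem prob_succ_le {v w : T.Node} (h : w ∈ T.succ v) : T.prob w ≤ T.prob v := by
  rw [← T.sum_prob_succ v ⟨w, h⟩]
  exact Finset.single_le_sum (f := T.prob) (fun x _ => (T.prob_pos x).le) h

/-! ### Cutting chain trees -/

/-- The edges of the tree that do not start in `G`. -/
def CutEdge (G : Set T.Node) (x y : T.Node) : Prop := x ∉ G ∧ y ∈ T.succ x

/-- The nodes that are reachable from `v₀` without leaving a node of `G`. -/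
abbrev CutNode (G : Set T.Node) (v₀ : T.Node) : Type :=
  {w : T.Node // Relation.ReflTransGen (T.CutEdge G) v₀ w}

open Classical in
/-- The successors in the subtree at `v₀` that is cut off at the nodes of `G`. -/
noncomputable def cutNodeSucc (G : Set T.Node) (v₀ : T.Node) (w : T.CutNode G v₀) :
    Finset (T.CutNode G v₀) :=
  (cutSucc T.succ G w.1).subtype fun x => Relation.ReflTransGen (T.CutEdge G) v₀ x

variable {T}

theorem mem_cutNodeSucc {G : Set T.Node} {v₀ : T.Node} {w x : T.CutNode G v₀} :
    x ∈ T.cutNodeSucc G v₀ w ↔ T.CutEdge G w.1 x.1 := by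
  classical
  rw [cutNodeSucc, cutSucc, CutEdge]
  refine Finset.mem_subtype.trans ?_
  by_cases h : w.1 ∈ G <;> simp [h]

theorem map_val_cutNodeSucc {G : Set T.Node} {v₀ : T.Node} (w : T.CutNode G v₀) :
    (T.cutNodeSucc G v₀ w).map ⟨Subtype.val, Subtype.val_injective⟩ = cutSucc T.succ G w.1 := by
  classical
  refine Finset.subtype_map_of_mem fun x hx => ?_
  rw [cutSucc] at hx
  split at hx
  · simp at hx
  · next h => exact w.2.tail ⟨h, hx⟩

theorem cutSucc_of_nonempty {G : Set T.Node} {v₀ : T.Node} {w : T.CutNode G v₀}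
    (h : (T.cutNodeSucc G v₀ w).Nonempty) : w.1 ∉ G := by
  obtain ⟨x, hx⟩ := h
  exact (mem_cutNodeSucc.1 hx).1

theorem map_cutNodeSucc {G : Set T.Node} {v₀ : T.Node} {w : T.CutNode G v₀} (hw : w.1 ∉ G) :
    ((T.cutNodeSucc G v₀ w).val.map fun x => (T.prob x.1 / T.prob v₀ /
      (T.prob w.1 / T.prob v₀), T.label x.1)) = T.succDist w.1 := by
  have h : (T.cutNodeSucc G v₀ w).val.map Subtype.val = (T.succ w.1).val := by
    have := congrArg Finset.val (map_val_cutNodeSucc w)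
    rwa [cutSucc, if_neg hw] at this
  rw [succDist, ← h, Multiset.map_map]
  refine Multiset.map_congr rfl fun x _ => ?_
  rw [Function.comp_apply, div_div_div_cancel_right₀ (T.prob_pos v₀).ne']

theorem transGen_of_cutEdge {G : Set T.Node} {x y : T.Node}
    (h : Relation.ReflTransGen (T.CutEdge G) x y) :
    Relation.ReflTransGen (fun x y => y ∈ T.succ x) x y :=
  Relation.ReflTransGen.mono (fun _ _ h => h.2) _ _ h

variable (T)

/-- The subtree at `v₀` where the nodes of `G` are made leaves, as a chain tree for a restricted
DP problem. -/
noncomputable def cut (Q' : DPProblem F X) (hS : Q'.S = Q.S) (G : Set T.Node)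
    (hG : ∀ v ∈ T.PNode, v ∉ G → TupleStep Q'.P Q.S (T.label v) (T.succDist v))
    (v₀ : T.Node) : ChainTree Q' where
  Node := T.CutNode G v₀
  root := ⟨v₀, .refl⟩
  succ := T.cutNodeSucc G v₀
  root_not_mem w hw := not_transGen_self T.root_not_mem T.unique_pred T.reachable v₀
    (Relation.TransGen.tail' (transGen_of_cutEdge w.2) (mem_cutNodeSucc.1 hw).2)
  unique_pred w hw := by
    rcases Relation.ReflTransGen.cases_tail w.2 with h | ⟨x, hx, hxw⟩
    · exact (hw (Subtype.ext h)).elim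
    · refine ⟨⟨x, hx⟩, mem_cutNodeSucc.2 hxw, fun y hy => Subtype.ext ?_⟩
      exact eq_of_mem_succ T.root_not_mem T.unique_pred (mem_cutNodeSucc.1 hy).2 hxw.2
  reachable := by
    rintro ⟨w, hw⟩
    induction hw with
    | refl => exact .refl
    | tail hb hbc ih => exact ih.tail (mem_cutNodeSucc.2 hbc)
  -- Normalised so that the new root has probability `1`; the transition probabilities are
  -- unchanged.
  prob w := T.prob w.1 / T.prob v₀
  prob_pos w := div_pos (T.prob_pos _) (T.prob_pos _)
  prob_le_one := by
    rintro ⟨w, hw⟩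
    refine (div_le_one (T.prob_pos _)).2 ?_
    induction hw with
    | refl => exact le_rfl
    | tail _ hbc ih => exact (T.prob_succ_le hbc.2).trans ih
  prob_root := div_self (T.prob_pos _).ne'
  label w := T.label w.1
  PNode := {w | w.1 ∈ T.PNode ∧ w.1 ∉ G}
  inner_of_PNode w hw := by
    obtain ⟨x, hx⟩ := T.inner_of_PNode w.1 hw.1
    exact ⟨⟨x, w.2.tail ⟨hw.2, hx⟩⟩, mem_cutNodeSucc.2 ⟨hw.2, hx⟩⟩
  tuple_step w hw := by
    rw [map_cutNodeSucc hw.2, hS]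
    exact hG w.1 hw.1 hw.2
  rule_step w hw h := by
    have hwG := cutSucc_of_nonempty h
    rw [map_cutNodeSucc hwG, hS]
    obtain ⟨x, hx⟩ := h
    exact T.rule_step w.1 (fun hP => hw ⟨hP, hwG⟩) ⟨x.1, (mem_cutNodeSucc.1 hx).2⟩
  -- Every node on an infinite path of the cut tree has a successor there and thus lies outside `G`,
  -- so no tuple step on the path is lost.
  infinite_PNode path hpath := by
    have h := T.infinite_PNode (fun n => (path n).1) fun n => (mem_cutNodeSucc.1 (hpath n)).2
    exact h.mono fun n hn => ⟨hn, (mem_cutNodeSucc.1 (hpath n)).1⟩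

/-- The cut subtree at `v₀` is a chain tree for the smaller problem, so its level masses vanish.
Multiplying by `T.prob v₀` undoes the normalisation. -/
theorem tendsto_cut_mass {Q' : DPProblem F X} (hQ' : Q'.IsIAST) (hS : Q'.S = Q.S)
    (G : Set T.Node)
    (hG : ∀ v ∈ T.PNode, v ∉ G → TupleStep Q'.P Q.S (T.label v) (T.succDist v))
    (v₀ : T.Node) :
    Tendsto (fun n => (succSum (cutSucc T.succ G))^[n] T.prob v₀) atTop (𝓝 0) := by
  have h := (leafProb_eq_one_iff _).1 (hQ' (T.cut Q' hS G hG v₀))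
  have key : ∀ n (w : T.CutNode G v₀), (succSum (cutSucc T.succ G))^[n] T.prob w.1 =
      T.prob v₀ * (succSum (T.cutNodeSucc G v₀))^[n] (fun w => T.prob w.1 / T.prob v₀) w := by
    intro n
    induction n with
    | zero =>
      intro w
      have := (T.prob_pos v₀).ne'
      simp only [Function.iterate_zero, id]
      field_simp
    | succ n ih =>
      intro w
      rw [iterate_succSum_succ, iterate_succSum_succ, ← map_val_cutNodeSucc, Finset.sum_map,
        Finset.mul_sum]
      exact Finset.sum_congr rfl fun x _ => ih x
  have h2 := h.const_mul (T.prob v₀)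
  rw [mul_zero] at h2
  exact h2.congr fun n => (key n ⟨v₀, .refl⟩).symm

/-- A chain tree for a subset of the dependency tuples is a chain tree for all of them. -/
def extend (Q' : DPProblem F X) (hP : Q.P ⊆ Q'.P) (hS : Q.S = Q'.S) : ChainTree Q' :=
  { T with
    tuple_step := fun v hv => hS ▸ (T.tuple_step v hv).mono hP
    rule_step := fun v hv h => hS ▸ T.rule_step v hv h }

end ChainTree

/-- A uniform positive lower bound for the probabilities of suitable right-hand sides. -/
theorem exists_uniform_weight {A B : Type*} {P : Set A} (hP : P.Finite)
    (μ : A → FDist B) (R : A → ℝ × B → Prop)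
    (h : ∀ δ ∈ P, ∃ y ∈ (μ δ).weights, R δ y) :
    ∃ ε : ℝ, 0 < ε ∧ ∀ δ ∈ P, ∃ y ∈ (μ δ).weights, ε ≤ y.1 ∧ R δ y := by
  induction P, hP using Set.Finite.induction_on with
  | empty => exact ⟨1, one_pos, by simp⟩
  | @insert a P _ _ ih =>
    obtain ⟨ε, hε, hP⟩ := ih fun δ hδ => h δ (Set.mem_insert_of_mem _ hδ)
    obtain ⟨y, hy, hR⟩ := h a (Set.mem_insert _ _)
    refine ⟨min ε y.1, lt_min hε ((μ a).pos y hy), fun δ hδ => ?_⟩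
    rcases hδ with rfl | hδ
    · exact ⟨y, hy, min_le_right _ _, hR⟩
    · obtain ⟨z, hz, hεz, hR'⟩ := hP δ hδ
      exact ⟨z, hz, (min_le_left _ _).trans hεz, hR'⟩

end ProbDP

/-! ### The reduction pair processor -/

open ProbDP
theorem mainTheorem4 {F : Signature} {X : Type*} (Q : DPProblem F X)
    (Pol : PolyInterp F) (hmono : Pol.WeaklyMonotonic) (hlin : Pol.Multilinear)
    (hadd : Pol.ComAdditive)
    (Pge Pgt : Set (DepTuple F X)) (hunion : Q.P = Pge ∪ Pgt) (hdisj : Disjoint Pge Pgt)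
    (hne : Pgt.Nonempty)
    (h1 : ∀ ρ ∈ Q.S, Pol.ExpectedGe ρ)
    (h2 : ∀ δ ∈ Q.P, Pol.ExpectedGe δ.proj₁)
    (h3 : ∀ δ ∈ Pgt, ∃ y ∈ δ.rhs.weights, Pol.Gt δ.lhs.sharp y.2.1 ∧
      (δ.proj₂ ∈ Q.S → Pol.Ge δ.lhs y.2.2)) :
    ProcessorSound Q {Q.restrict Pge (hunion ▸ Set.subset_union_left)} ∧
      ProcessorComplete Q {Q.restrict Pge (hunion ▸ Set.subset_union_left)} := by
  have hsub : Pge ⊆ Q.P := hunion ▸ Set.subset_union_left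
  constructor
  · intro hR T
    obtain ⟨ε, hε, h3'⟩ := exists_uniform_weight
      (Q.isPPTRS.1.subset (hunion ▸ Set.subset_union_right)) DepTuple.rhs
      (fun δ y => Pol.Gt δ.lhs.sharp y.2.1 ∧ (δ.proj₂ ∈ Q.S → Pol.Ge δ.lhs y.2.2)) h3
    -- With `G` as the nodes where `Pge` fails, all remaining tuple steps are `Pge`-steps by
    -- definition, and on `G` a `Pgt`-step is forced.
    set G : Set T.Node :=
      {v | v ∈ T.PNode ∧ ¬ TupleStep Pge Q.S (T.label v) (T.succDist v)} with hGdef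
    have hcut := T.tendsto_cut_mass (hR _ rfl) rfl G
      fun v hv hvG => by_contra fun h => hvG ⟨hv, h⟩
    refine T.leafProb_eq_one_iff.2 (tendsto_mass_zero T.prob_pos T.sum_prob_succ
      -- Any fixed instantiation of the variables would serve; the zero instantiation is chosen.
      (V := fun v => Pol.eval 0 (T.label v))
      (T.sum_prob_mul_eval_succ_le hlin hadd h1 h2 0) hε (fun v hv => ?_) hcut T.root)
    have hstep : TupleStep Pgt Q.S (T.label v) (T.succDist v) := by
      have := T.tuple_step v hv.1
      rw [hunion] at this
      exact this.of_union.resolve_left hv.2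
    obtain ⟨x, hx, hεx, hlt⟩ := hstep.exists_eval_lt hlin hadd h3' 0
    obtain ⟨w, hw, rfl⟩ := Multiset.mem_map.1 hx
    exact ⟨w, hw, hlt, (le_div_iff₀ (T.prob_pos v)).1 hεx⟩
  · rintro hQ _ rfl T
    exact hQ (T.extend Q hsub rfl)
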